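/- Let $r\ge 1$, let $\eta_1,\dots,\eta_r\in\mathbb R$ be pairwise distinct, let $\mu_1,\dots,\mu_r\ge 1$ be integers, $m=\mu_1+\dots+\mu_r$, and let $\Lambda=(\lambda_1,\dots,\lambda_m)$ be the tuple in which each $\eta_j$ is repeated $\mu_j$ times. Let $$B_\Lambda=e^{\lambda_1(\cdot)}\chi_{[0,1)}*\cdots*e^{\lambda_m(\cdot)}\chi_{[0,1)}$$ be the exponential B-spline (EB-spline) with weights $\Lambda$, and let $\mathrm Zf(x,\omega)=\sum_{k\in\mathbb Z}f(x+k)e^{-2\pi i k\omega}$ be the Zak transform. For $1\le n\le r$ let $$D_nf(x)=e^{\eta_n x}\frac{d}{dx}\bigl(e^{-\eta_n x}f(x)\bigr),$$ where $\frac{d}{dx}$ denotes the right-sided derivative (which is the ordinary derivative wherever $f$ is differentiable). Then the series defining $h:=\mathrm ZB_\Lambda(\cdot,\tfrac12)$ converges absolutely at every point and $h$ is real-valued. The function $h$ has a right-sided derivative at every point of $\mathbb R$; it is differentiable at every non-integer point, and on all of $\mathbb R$ if $m\ge 3$. Moreover: 1. There is $x_0\in\mathbb R$ such that for every $k\in\mathbb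 Z$ the function $h$ is monotone (nondecreasing or nonincreasing) on $[x_0+k,x_0+k+1)$. 2. For every $n\in\{1,\dots,r\}$ there is $y_0\in\mathbb R$ (which may depend on $n$) such that for every $k\in\mathbb Z$ the function $D_nh$ is monotone (nondecreasing or nonincreasing) on $[y_0+k,y_0+k+1)$. -/

import Mathlib

noncomputable section

/-- The function `e^{a x} χ_{[0,1)}(x)`. -/
def expBox (a : ℝ) : ℝ → ℝ :=
  Set.indicator (Set.Ico (0 : ℝ) 1) (fun x => Real.exp (a * x))

/-- The exponential B-spline of the weights `Λ = (a₁, …, aₘ)`, `m ≥ 1`, with knots `0, 1, …, m`: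
the `m`-fold convolution `e^{a₁ ·}χ_{[0,1)} ∗ ⋯ ∗ e^{aₘ ·}χ_{[0,1)}`. The empty tuple of weights
carries no spline; the value there is a placeholder. -/
def ebSpline : List ℝ → ℝ → ℝ
  | [] => 0
  | [a] => expBox a
  | a :: b :: l =>
      MeasureTheory.convolution (expBox a) (ebSpline (b :: l))
        (ContinuousLinearMap.mul ℝ ℝ) MeasureTheory.volume

/-- The tuple `(η₁, …, η₁, …, ηᵣ, …, ηᵣ)` in which `ηⱼ` is repeated `μⱼ` times. -/
def weightList {r : ℕ} (η : Fin r → ℝ) (μ : Fin r → ℕ) : List ℝ :=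
  (List.ofFn fun j => List.replicate (μ j) (η j)).flatten

/-- The `k`-th term `f(x + k) e^{-2πikω}` of the Zak transform. -/
def zakTerm (f : ℝ → ℂ) (x ω : ℝ) (k : ℤ) : ℂ :=
  f (x + k) * Complex.exp (-2 * Real.pi * Complex.I * k * ω)

/-- The Zak transform `Zf(x, ω) = ∑_{k ∈ ℤ} f(x + k) e^{-2πikω}`. -/
def zak (f : ℝ → ℂ) (x ω : ℝ) : ℂ := ∑' k : ℤ, zakTerm f x ω k

/-- The operator `f ↦ e^{a x} (d/dx) (e^{-a x} f(x)) = f'(x) - a f(x)`. The derivative is taken from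
the right, so that a function with corners or jumps at the knots gets its right-sided value there;
wherever `f` is differentiable this is the ordinary derivative. -/
def expDeriv (a : ℝ) (f : ℝ → ℝ) (x : ℝ) : ℝ :=
  Real.exp (a * x) * derivWithin (fun t => Real.exp (-(a * t)) * f t) (Set.Ici x) x

/-- `f` is monotone (nondecreasing or nonincreasing) on `s`. -/
def IsMonotoneOn (f : ℝ → ℝ) (s : Set ℝ) : Prop :=
  MonotoneOn f s ∨ AntitoneOn f s

/-- Sanity check of the operator: where `f` is differentiable it is `f' - a f`. -/
theorem expDeriv_eq_of_differentiableAt (a : ℝ) (f : ℝ → ℝ) (x : ℝ)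
    (hf : DifferentiableAt ℝ f x) : expDeriv a f x = deriv f x - a * f x := by
  have h1 : HasDerivAt (fun t : ℝ => Real.exp (-(a * t))) (Real.exp (-(a * x)) * -(a * 1)) x :=
    (((hasDerivAt_id x).const_mul a).neg).exp
  have h2 := (h1.mul hf.hasDerivAt).hasDerivWithinAt (s := Set.Ici x)
  have h3 : derivWithin (fun t => Real.exp (-(a * t)) * f t) (Set.Ici x) x
      = Real.exp (-(a * x)) * -(a * 1) * f x + Real.exp (-(a * x)) * deriv f x :=
    h2.derivWithin (uniqueDiffOn_Ici x x Set.self_mem_Ici)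
  have h4 : Real.exp (a * x) * Real.exp (-(a * x)) = 1 := by
    rw [← Real.exp_add]; simp
  unfold expDeriv
  rw [h3]
  linear_combination (deriv f x - a * f x) * h4

end

open MeasureTheory Set Filter Topology

/-! At `ω = 1/2` the Zak transform is the alternating sum `∑ (-1)^k f(x + k)`, which is antiperiodic
with period 1. It turns convolution with `expBox a` into the operator `expMean a`, so `h` arises
from `antiExp` by iterating `expMean`. It remains to see that `expMean a` preserves monotonicity on
some period.

Let `g` be antiperiodic and nondecreasing on a period, and let `f = expMean a g`. Then the right
derivative of `f` is `G = (1 + e^a) g + a f` (`expMean_eq_add_integral`). Formally `d(e^{-ax} G) =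
(1 + e^a) e^{-ax} dg ≥ 0`, so `G` changes sign at most once on the period, from `-` to `+`. By
antiperiodicity `G ≥ 0` on the period that starts at the sign change, and `f` is nondecreasing
there. The jumps of `antiExp` at the integers force one-sided derivatives and right continuity.

For `D_n h`, commutativity of convolution lets `η_n` come first; then `D_n h = (1 + e^{η_n})` times
the alternating sum for the remaining weights, or `0` if none remain. -/

/-- The mean `∫₀¹ e^{a s} g(x - s) ds`. -/
noncomputable def expMean (a : ℝ) (g : ℝ → ℝ) (x : ℝ) : ℝ :=
  ∫ s in (0 : ℝ)..1, Real.exp (a * s) * g (x - s)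

/-- The function with `f (x + 1) = -f x` that equals `e^{a x}` on `[0, 1)`. -/
noncomputable def antiExp (a : ℝ) (x : ℝ) : ℝ :=
  (-1) ^ ⌊x⌋ * Real.exp (a * Int.fract x)

/-- Right-continuous, locally integrable functions with `g (x + 1) = -g x` that are monotone on some
period `[x₀, x₀ + 1)`. -/
structure IsMonotoneAntiperiodic (g : ℝ → ℝ) : Prop where
  antiperiodic : Function.Antiperiodic g 1
  rightContinuous : ∀ x, ContinuousWithinAt g (Ici x) x
  locallyIntegrable : LocallyIntegrable g
  exists_monotoneOn : ∃ x₀, MonotoneOn g (Ico x₀ (x₀ + 1))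

/-- A shift by one period flips the sign, so asking only for nondecreasing functions in
`IsMonotoneAntiperiodic` loses nothing. -/
theorem Function.Antiperiodic.monotoneOn_of_antitoneOn {g : ℝ → ℝ}
    (hg : Function.Antiperiodic g 1) {x₀ : ℝ} (h : AntitoneOn g (Ico x₀ (x₀ + 1))) :
    MonotoneOn g (Ico (x₀ + 1) (x₀ + 1 + 1)) := by
  intro x hx y hy hxy
  have h1 := h (a := x - 1) (b := y - 1) ⟨by linarith [hx.1], by linarith [hx.2]⟩
    ⟨by linarith [hy.1], by linarith [hy.2]⟩ (by linarith)
  rw [hg.sub_eq, hg.sub_eq] at h1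
  linarith

theorem Function.Antiperiodic.isMonotoneOn_Ico {g : ℝ → ℝ} (hg : Function.Antiperiodic g 1)
    {x₀ : ℝ} (h : MonotoneOn g (Ico x₀ (x₀ + 1))) (k : ℤ) :
    IsMonotoneOn g (Ico (x₀ + k) (x₀ + k + 1)) := by
  have key : ∀ x, g x = ((k.negOnePow : ℤ) : ℝ) * g (x - k) := by
    intro x
    have := hg.add_int_mul_eq (x := x - k) k
    simpa using this
  have mem : ∀ {x}, x ∈ Ico (x₀ + k) (x₀ + k + 1) → x - k ∈ Ico x₀ (x₀ + 1) := by
    intro x hx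
    exact ⟨by linarith [hx.1], by linarith [hx.2]⟩
  rcases Int.even_or_odd k with hk | hk
  · left
    intro x hx y hy hxy
    rw [key x, key y, Int.negOnePow_even k hk]
    simpa using h (mem hx) (mem hy) (by linarith)
  · right
    intro x hx y hy hxy
    rw [key x, key y, Int.negOnePow_odd k hk]
    simpa using h (mem hx) (mem hy) (by linarith)

theorem IsMonotoneOn.const_mul {f : ℝ → ℝ} {s : Set ℝ} (h : IsMonotoneOn f s) {c : ℝ}
    (hc : 0 ≤ c) : IsMonotoneOn (fun x => c * f x) s := by
  rcases h with h | h
  · exact Or.inl fun x hx y hy hxy => mul_le_mul_of_nonneg_left (h hx hy hxy) hc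
  · exact Or.inr fun x hx y hy hxy => mul_le_mul_of_nonneg_left (h hx hy hxy) hc

/-! ### The function `antiExp` -/

theorem antiExp_antiperiodic (a : ℝ) : Function.Antiperiodic (antiExp a) 1 := by
  intro x
  simp [antiExp, zpow_add_one₀]

theorem antiExp_eq_of_mem {a x : ℝ} {n : ℤ} (hx : x ∈ Ico (n : ℝ) (n + 1)) :
    antiExp a x = (-1) ^ n * Real.exp (a * (x - n)) := by
  have h : ⌊x⌋ = n := Int.floor_eq_iff.2 hx
  simp [antiExp, Int.fract, h]

theorem hasDerivAt_exp_floor (a x : ℝ) :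
    HasDerivAt (fun y : ℝ => (-1 : ℝ) ^ ⌊x⌋ * Real.exp (a * (y - ⌊x⌋))) (a * antiExp a x) x := by
  have h : HasDerivAt (fun y : ℝ => a * (y - ⌊x⌋)) (a * 1) x :=
    ((hasDerivAt_id x).sub_const _).const_mul a
  refine (h.exp.const_mul ((-1 : ℝ) ^ ⌊x⌋)).congr_deriv ?_
  rw [antiExp, Int.fract]
  ring

theorem hasDerivWithinAt_antiExp (a x : ℝ) :
    HasDerivWithinAt (antiExp a) (a * antiExp a x) (Ici x) x := by
  refine (hasDerivAt_exp_floor a x).hasDerivWithinAt.congr_of_eventuallyEq ?_ ?_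
  · filter_upwards [Ico_mem_nhdsGE (Int.lt_floor_add_one x)] with y hy
    exact antiExp_eq_of_mem ⟨(Int.floor_le x).trans hy.1, hy.2⟩
  · exact antiExp_eq_of_mem ⟨Int.floor_le x, Int.lt_floor_add_one x⟩

theorem hasDerivAt_antiExp (a : ℝ) {x : ℝ} (hx : ∀ k : ℤ, x ≠ k) :
    HasDerivAt (antiExp a) (a * antiExp a x) x := by
  refine (hasDerivAt_exp_floor a x).congr_of_eventuallyEq ?_
  have h : (⌊x⌋ : ℝ) < x := lt_of_le_of_ne (Int.floor_le x) (hx _).symm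
  filter_upwards [Ioo_mem_nhds h (Int.lt_floor_add_one x)] with y hy
  exact antiExp_eq_of_mem ⟨hy.1.le, hy.2⟩

theorem locallyIntegrable_antiExp (a : ℝ) : LocallyIntegrable (antiExp a) := by
  have hm : Measurable (antiExp a) := by
    have h1 : Measurable fun x : ℝ => (-1 : ℝ) ^ ⌊x⌋ :=
      (measurable_of_countable fun n : ℤ => (-1 : ℝ) ^ n).comp Int.measurable_floor
    exact h1.mul (Real.measurable_exp.comp (measurable_fract.const_mul a))
  refine (locallyIntegrable_const (Real.exp |a|)).mono hm.aestronglyMeasurable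
    (Eventually.of_forall fun x => ?_)
  have h1 : a * Int.fract x ≤ |a| := by
    nlinarith [le_abs_self a, abs_nonneg a, Int.fract_nonneg x, (Int.fract_lt_one x).le,
      mul_nonneg (Int.fract_nonneg x) (sub_nonneg.2 (le_abs_self a)),
      mul_nonneg (abs_nonneg a) (sub_nonneg.2 (Int.fract_lt_one x).le)]
  simpa [antiExp] using h1

theorem isMonotoneAntiperiodic_antiExp (a : ℝ) : IsMonotoneAntiperiodic (antiExp a) where
  antiperiodic := antiExp_antiperiodic a
  rightContinuous x := (hasDerivWithinAt_antiExp a x).continuousWithinAt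
  locallyIntegrable := locallyIntegrable_antiExp a
  exists_monotoneOn := by
    have key : ∀ x ∈ Ico (0 : ℝ) (0 + 1), antiExp a x = Real.exp (a * x) := by
      intro x hx
      have := antiExp_eq_of_mem (a := a) (n := 0) (x := x) (by simpa using hx)
      simpa using this
    rcases le_total 0 a with ha | ha
    · refine ⟨0, fun x hx y hy hxy => ?_⟩
      rw [key x hx, key y hy]
      exact Real.exp_le_exp.2 (mul_le_mul_of_nonneg_left hxy ha)
    · refine ⟨0 + 1, (antiExp_antiperiodic a).monotoneOn_of_antitoneOn
        fun x hx y hy hxy => ?_⟩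
      rw [key x hx, key y hy]
      exact Real.exp_le_exp.2 (mul_le_mul_of_nonpos_left hxy ha)

/-! ### The operator `expMean` -/

theorem locallyIntegrable_exp_neg_mul {g : ℝ → ℝ} (hg : LocallyIntegrable g) (a : ℝ) :
    LocallyIntegrable fun t => Real.exp (-(a * t)) * g t :=
  hg.continuous_mul (by fun_prop)

theorem MeasureTheory.LocallyIntegrable.intervalIntegrable_of_real {g : ℝ → ℝ}
    (hg : LocallyIntegrable g) (x y : ℝ) : IntervalIntegrable g volume x y :=
  (hg.integrableOn_isCompact isCompact_uIcc).intervalIntegrable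

theorem expMean_eq_integral (a : ℝ) (g : ℝ → ℝ) (x : ℝ) :
    expMean a g x = Real.exp (a * x) * ∫ t in (x - 1)..x, Real.exp (-(a * t)) * g t := by
  have h := intervalIntegral.integral_comp_sub_left (a := (0 : ℝ)) (b := 1)
    (fun t => Real.exp (-(a * t)) * g t) x
  rw [sub_zero] at h
  rw [← h, expMean, ← intervalIntegral.integral_const_mul]
  congr 1
  ext s
  rw [← mul_assoc, ← Real.exp_add]
  ring_nf

theorem Function.Antiperiodic.expMean {g : ℝ → ℝ} (hg : Function.Antiperiodic g 1) (a : ℝ) :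
    Function.Antiperiodic (expMean a g) 1 := by
  intro x
  simp only [_root_.expMean]
  rw [← intervalIntegral.integral_neg]
  congr 1
  ext s
  rw [show x + 1 - s = x - s + 1 by ring, hg]
  ring

/-- Integrated form of `f' = a f + (1 + e^a) g`. Moving the window from `[x-1, x]` to `[y-1, y]`
gains the integral over `[x, y]` and loses that over `[x-1, y-1]`, which antiperiodicity makes
`-e^a` times the former. -/
theorem expMean_eq_add_integral {g : ℝ → ℝ} (hg : Function.Antiperiodic g 1)
    (hi : LocallyIntegrable g) (a x y : ℝ) :
    expMean a g y = Real.exp (a * y) * (Real.exp (-(a * x)) * expMean a g x +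
      (1 + Real.exp a) * ∫ t in x..y, Real.exp (-(a * t)) * g t) := by
  set p : ℝ → ℝ := fun t => Real.exp (-(a * t)) * g t with hp
  have hpi : ∀ u v, IntervalIntegrable p volume u v :=
    (locallyIntegrable_exp_neg_mul hi a).intervalIntegrable_of_real
  have h1 : ∫ t in (x - 1)..(y - 1), p t = -(Real.exp a * ∫ t in x..y, p t) := by
    rw [← intervalIntegral.integral_comp_sub_right, ← neg_mul,
      ← intervalIntegral.integral_const_mul]
    congr 1
    ext t
    simp only [hp]
    rw [hg.sub_eq, show -(a * (t - 1)) = a + -(a * t) by ring, Real.exp_add]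
    ring
  have h2 : ∫ t in (y - 1)..y, p t =
      (∫ t in (x - 1)..x, p t) + (∫ t in x..y, p t) - ∫ t in (x - 1)..(y - 1), p t := by
    rw [intervalIntegral.integral_add_adjacent_intervals (hpi _ _) (hpi _ _),
      intervalIntegral.integral_interval_sub_left (hpi _ _) (hpi _ _)]
  rw [expMean_eq_integral, expMean_eq_integral, h2, h1, ← mul_assoc (Real.exp (-(a * x))),
    ← Real.exp_add, neg_add_cancel, Real.exp_zero]
  ring

theorem hasDerivWithinAt_expMean_of_hasDerivWithinAt {g : ℝ → ℝ} (hg : Function.Antiperiodic g 1)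
    (hi : LocallyIntegrable g) (a x : ℝ) (s : Set ℝ)
    (h : HasDerivWithinAt (fun y => ∫ t in x..y, Real.exp (-(a * t)) * g t)
      (Real.exp (-(a * x)) * g x) s x) :
    HasDerivWithinAt (expMean a g) ((1 + Real.exp a) * g x + a * expMean a g x) s x := by
  have h1 : HasDerivWithinAt (fun y : ℝ => Real.exp (a * y)) (Real.exp (a * x) * (a * 1)) s x :=
    (((hasDerivAt_id x).const_mul a).exp).hasDerivWithinAt
  have h2 := h1.mul ((h.const_mul (1 + Real.exp a)).const_add
    (Real.exp (-(a * x)) * expMean a g x))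
  have h3 : Real.exp (a * x) * Real.exp (-(a * x)) = 1 := by rw [← Real.exp_add]; simp
  refine (h2.congr_of_eventuallyEq (Eventually.of_forall fun y =>
    expMean_eq_add_integral hg hi a x y) (expMean_eq_add_integral hg hi a x x)).congr_deriv ?_
  simp only [intervalIntegral.integral_same, mul_zero, add_zero]
  linear_combination (a * expMean a g x + (1 + Real.exp a) * g x) * h3

theorem hasDerivWithinAt_expMean {g : ℝ → ℝ} (hg : Function.Antiperiodic g 1)
    (hi : LocallyIntegrable g) (a : ℝ) {x : ℝ} (hc : ContinuousWithinAt g (Ici x) x) :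
    HasDerivWithinAt (expMean a g) ((1 + Real.exp a) * g x + a * expMean a g x) (Ici x) x := by
  refine hasDerivWithinAt_expMean_of_hasDerivWithinAt hg hi a x _ ?_
  have hp := locallyIntegrable_exp_neg_mul hi a
  refine intervalIntegral.integral_hasDerivWithinAt_right (t := Ioi x)
    (hp.intervalIntegrable_of_real x x)
    (hp.aestronglyMeasurable.stronglyMeasurableAtFilter) ?_
  have h : Continuous fun t : ℝ => Real.exp (-(a * t)) := by fun_prop
  exact h.continuousWithinAt.mul (hc.mono Ioi_subset_Ici_self)

theorem hasDerivAt_expMean {g : ℝ → ℝ} (hg : Function.Antiperiodic g 1)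
    (hi : LocallyIntegrable g) (a : ℝ) {x : ℝ} (hc : ContinuousAt g x) :
    HasDerivAt (expMean a g) ((1 + Real.exp a) * g x + a * expMean a g x) x := by
  rw [← hasDerivWithinAt_univ]
  refine hasDerivWithinAt_expMean_of_hasDerivWithinAt hg hi a x _ ?_
  rw [hasDerivWithinAt_univ]
  have hp := locallyIntegrable_exp_neg_mul hi a
  refine intervalIntegral.integral_hasDerivAt_right (hp.intervalIntegrable_of_real x x)
    (hp.aestronglyMeasurable.stronglyMeasurableAtFilter) ?_
  have h : Continuous fun t : ℝ => Real.exp (-(a * t)) := by fun_prop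
  exact h.continuousAt.mul hc

theorem continuous_expMean {g : ℝ → ℝ} (hg : Function.Antiperiodic g 1)
    (hi : LocallyIntegrable g) (a : ℝ) : Continuous (expMean a g) := by
  have hp := locallyIntegrable_exp_neg_mul hi a
  have h := intervalIntegral.continuous_primitive hp.intervalIntegrable_of_real 0
  rw [funext (expMean_eq_add_integral hg hi a 0)]
  fun_prop

theorem expDeriv_eq_of_hasDerivWithinAt {f : ℝ → ℝ} {a x f' : ℝ}
    (h : HasDerivWithinAt f f' (Ici x) x) : expDeriv a f x = f' - a * f x := by
  have h1 : HasDerivAt (fun t : ℝ => Real.exp (-(a * t))) (Real.exp (-(a * x)) * -(a * 1)) x :=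
    (((hasDerivAt_id x).const_mul a).neg).exp
  have h3 : derivWithin (fun t => Real.exp (-(a * t)) * f t) (Ici x) x
      = Real.exp (-(a * x)) * -(a * 1) * f x + Real.exp (-(a * x)) * f' :=
    (h1.hasDerivWithinAt.mul h).derivWithin (uniqueDiffOn_Ici x x self_mem_Ici)
  have h4 : Real.exp (a * x) * Real.exp (-(a * x)) = 1 := by rw [← Real.exp_add]; simp
  rw [expDeriv, h3]
  linear_combination (f' - a * f x) * h4

theorem integral_const_mul_exp (a x y : ℝ) :
    ∫ t in x..y, a * Real.exp (-(a * t)) = Real.exp (-(a * x)) - Real.exp (-(a * y)) := by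
  have h : ∀ t ∈ uIcc x y, HasDerivAt (fun t : ℝ => -Real.exp (-(a * t)))
      (a * Real.exp (-(a * t))) t := by
    intro t _
    have := (((hasDerivAt_id t).const_mul a).neg).exp.neg
    refine this.congr_deriv ?_
    simp
    ring
  rw [intervalIntegral.integral_eq_sub_of_hasDerivAt h
    (Continuous.intervalIntegrable (by fun_prop) _ _)]
  ring

/-- If `g` is monotone, then so is `e^{-a x}` times the derivative of `expMean a g`. -/
theorem monotoneOn_exp_neg_mul_deriv_expMean {g : ℝ → ℝ} (hg : Function.Antiperiodic g 1)
    (hi : LocallyIntegrable g) (a : ℝ) {x₀ : ℝ} (hm : MonotoneOn g (Ico x₀ (x₀ + 1))) :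
    MonotoneOn (fun x => Real.exp (-(a * x)) * ((1 + Real.exp a) * g x + a * expMean a g x))
      (Ico x₀ (x₀ + 1)) := by
  intro x hx y hy hxy
  have hp := (locallyIntegrable_exp_neg_mul hi a).intervalIntegrable_of_real x y
  have hq : IntervalIntegrable (fun t => a * Real.exp (-(a * t))) volume x y :=
    Continuous.intervalIntegrable (by fun_prop) _ _
  have mem : ∀ t ∈ Icc x y, t ∈ Ico x₀ (x₀ + 1) := fun t ht =>
    ⟨hx.1.trans ht.1, ht.2.trans_lt hy.2⟩
  have h4 : Real.exp (-(a * y)) * Real.exp (a * y) = 1 := by rw [← Real.exp_add]; simp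
  -- Integration by parts without differentiating `g`: bound `g t` by `g x` if `a ≥ 0` and by `g y`
  -- if `a ≤ 0`, then integrate `a e^{-at}` exactly. What is left is an exponential times `g y - g
  -- x`.
  have key : 0 ≤ Real.exp (-(a * y)) * g y - Real.exp (-(a * x)) * g x
      + a * ∫ t in x..y, Real.exp (-(a * t)) * g t := by
    rw [← intervalIntegral.integral_const_mul]
    rcases le_total 0 a with ha | ha
    · have h1 : ∫ t in x..y, (a * Real.exp (-(a * t))) * g x ≤
          ∫ t in x..y, a * (Real.exp (-(a * t)) * g t) := by
        refine intervalIntegral.integral_mono_on hxy (hq.mul_const _) (hp.const_mul _)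
          fun t ht => ?_
        rw [mul_assoc]
        exact mul_le_mul_of_nonneg_left (mul_le_mul_of_nonneg_left
          (hm hx (mem t ht) ht.1) (Real.exp_pos _).le) ha
      rw [intervalIntegral.integral_mul_const, integral_const_mul_exp] at h1
      have h2 := mul_le_mul_of_nonneg_left (hm hx hy hxy) (Real.exp_pos (-(a * y))).le
      linarith
    · have h1 : ∫ t in x..y, (a * Real.exp (-(a * t))) * g y ≤
          ∫ t in x..y, a * (Real.exp (-(a * t)) * g t) := by
        refine intervalIntegral.integral_mono_on hxy (hq.mul_const _) (hp.const_mul _)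
          fun t ht => ?_
        rw [mul_assoc]
        exact mul_le_mul_of_nonpos_left (mul_le_mul_of_nonneg_left
          (hm (mem t ht) hy ht.2) (Real.exp_pos _).le) ha
      rw [intervalIntegral.integral_mul_const, integral_const_mul_exp] at h1
      have h2 := mul_le_mul_of_nonneg_left (hm hx hy hxy) (Real.exp_pos (-(a * x))).le
      linarith
  have h5 : 0 ≤ 1 + Real.exp a := by positivity
  have h6 := mul_nonneg h5 key
  dsimp only
  rw [expMean_eq_add_integral hg hi a x y]
  set I := ∫ t in x..y, Real.exp (-(a * t)) * g t
  have h7 : Real.exp (-(a * y)) * ((1 + Real.exp a) * g y + a * (Real.exp (a * y) *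
      (Real.exp (-(a * x)) * expMean a g x + (1 + Real.exp a) * I))) =
      Real.exp (-(a * y)) * (1 + Real.exp a) * g y +
      a * (Real.exp (-(a * x)) * expMean a g x + (1 + Real.exp a) * I) := by
    linear_combination (a * (Real.exp (-(a * x)) * expMean a g x + (1 + Real.exp a) * I)) * h4
  rw [h7]
  linarith

/-! ### Monotonicity is preserved by `expMean` -/

/-- An antiperiodic function that changes sign at most once, from `-` to `+`, on a period is
nonnegative on some period. -/
theorem Function.Antiperiodic.exists_nonneg_of_monotoneOn {G : ℝ → ℝ}
    (hG : Function.Antiperiodic G 1) (hc : ∀ x, ContinuousWithinAt G (Ici x) x) (w : ℝ → ℝ)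
    (hw : ∀ x, 0 < w x) {x₀ : ℝ} (hm : MonotoneOn (fun x => w x * G x) (Ico x₀ (x₀ + 1))) :
    ∃ x₁, ∀ x ∈ Ico x₁ (x₁ + 1), 0 ≤ G x := by
  set A : Set ℝ := {x | x ∈ Ico x₀ (x₀ + 1) ∧ G x < 0} with hA
  rcases A.eq_empty_or_nonempty with hE | hne
  · refine ⟨x₀, fun x hx => ?_⟩
    by_contra hlt
    have : x ∈ A := ⟨hx, not_le.1 hlt⟩
    rw [hE] at this
    exact this
  have hbdd : BddAbove A := ⟨x₀ + 1, fun x hx => hx.1.2.le⟩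
  -- The point of the sign change, and the start of the new period.
  set x₁ := sSup A with hx₁
  have hlow : x₀ ≤ x₁ := by
    obtain ⟨z, hz⟩ := hne
    exact hz.1.1.trans (le_csSup hbdd hz)
  have hup : x₁ ≤ x₀ + 1 := csSup_le hne fun x hx => hx.1.2.le
  have hneg : ∀ x, x₀ ≤ x → x < x₁ → G x < 0 := by
    intro x h0 h1
    obtain ⟨z, hz, hxz⟩ := exists_lt_of_lt_csSup hne h1
    have h2 := hm ⟨h0, hxz.trans hz.1.2⟩ hz.1 hxz.le
    have h3 : w z * G z < 0 := mul_neg_of_pos_of_neg (hw z) hz.2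
    have h4 : w x * G x < 0 := h2.trans_lt h3
    by_contra h5
    exact absurd h4 (not_lt.2 (mul_nonneg (hw x).le (not_lt.1 h5)))
  have hpos : ∀ x ∈ Ioo x₁ (x₁ + 1), 0 ≤ G x := by
    intro x hx
    rcases lt_or_ge x (x₀ + 1) with h | h
    · by_contra h5
      exact absurd (le_csSup hbdd (⟨⟨hlow.trans hx.1.le, h⟩, not_le.1 h5⟩ : x ∈ A))
        (not_le.2 hx.1)
    -- Past the old period, `x - 1` lies before the sign change, and antiperiodicity flips the
    -- negative value.
    · have h1 := hneg (x - 1) (by linarith) (by linarith [hx.2])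
      rw [hG.sub_eq] at h1
      linarith
  refine ⟨x₁, fun x hx => ?_⟩
  rcases hx.1.eq_or_lt with h | h
  · subst h
    refine ge_of_tendsto ((hc x₁).mono Ioi_subset_Ici_self) ?_
    filter_upwards [Ioo_mem_nhdsGT (show x₁ < x₁ + 1 by linarith)] with y hy using hpos y hy
  · exact hpos x ⟨h, hx.2⟩

theorem monotoneOn_Ico_of_rightDeriv_nonneg {f f' : ℝ → ℝ} {a b : ℝ} (hf : Continuous f)
    (hf' : ∀ x, HasDerivWithinAt f (f' x) (Ici x) x) (h0 : ∀ x ∈ Ico a b, 0 ≤ f' x) :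
    MonotoneOn f (Ico a b) := by
  intro x hx y hy hxy
  exact image_le_of_deriv_right_le_deriv_boundary (f := fun _ => f x) (f' := fun _ => 0)
    (B := f) (B' := f') (a := x) (b := y) continuousOn_const
    (fun z _ => hasDerivWithinAt_const _ _ _) le_rfl hf.continuousOn (fun z _ => hf' z)
    (fun z hz => h0 z ⟨hx.1.trans hz.1, hz.2.trans hy.2⟩) ⟨hxy, le_rfl⟩

theorem IsMonotoneAntiperiodic.expMean {g : ℝ → ℝ} (hg : IsMonotoneAntiperiodic g) (a : ℝ) :
    IsMonotoneAntiperiodic (expMean a g) := by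
  have hT := hg.antiperiodic.expMean a
  have hcont := continuous_expMean hg.antiperiodic hg.locallyIntegrable a
  refine ⟨hT, fun x => hcont.continuousWithinAt, hcont.locallyIntegrable, ?_⟩
  obtain ⟨x₀, hx₀⟩ := hg.exists_monotoneOn
  have hG : Function.Antiperiodic
      (fun x => (1 + Real.exp a) * g x + a * _root_.expMean a g x) 1 := by
    intro x
    simp only [hg.antiperiodic x, hT x]
    ring
  obtain ⟨x₁, hx₁⟩ := hG.exists_nonneg_of_monotoneOn
    (fun x => ((hg.rightContinuous x).const_mul _).add (hcont.continuousWithinAt.const_mul _))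
    (fun x => Real.exp (-(a * x))) (fun x => Real.exp_pos _)
    (monotoneOn_exp_neg_mul_deriv_expMean hg.antiperiodic hg.locallyIntegrable a hx₀)
  exact ⟨x₁, monotoneOn_Ico_of_rightDeriv_nonneg hcont (fun x => hasDerivWithinAt_expMean
    hg.antiperiodic hg.locallyIntegrable a (hg.rightContinuous x)) hx₁⟩

/-! ### Recursive form of the alternating sum -/

/-- The alternating sum `∑ₖ (-1)ᵏ B(x + k)` of the exponential B-spline, in recursive form. -/
noncomputable def zakHalf : List ℝ → ℝ → ℝ
  | [] => 0
  | [a] => antiExp a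
  | a :: b :: l => expMean a (zakHalf (b :: l))

theorem zakHalf_cons {l : List ℝ} (hl : l ≠ []) (a : ℝ) :
    zakHalf (a :: l) = expMean a (zakHalf l) := by
  cases l with
  | nil => exact absurd rfl hl
  | cons b l => rfl

theorem ebSpline_cons {l : List ℝ} (hl : l ≠ []) (a : ℝ) :
    ebSpline (a :: l) = MeasureTheory.convolution (expBox a) (ebSpline l)
      (ContinuousLinearMap.mul ℝ ℝ) volume := by
  cases l with
  | nil => exact absurd rfl hl
  | cons b l => rfl

theorem isMonotoneAntiperiodic_zakHalf {l : List ℝ} (hl : l ≠ []) :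
    IsMonotoneAntiperiodic (zakHalf l) := by
  induction l with
  | nil => exact absurd rfl hl
  | cons a l ih =>
    rcases eq_or_ne l [] with rfl | h
    · exact isMonotoneAntiperiodic_antiExp a
    · rw [zakHalf_cons h]
      exact (ih h).expMean a

/-! ### Integrability and symmetry of the spline -/

theorem integrable_expBox (a : ℝ) : Integrable (expBox a) := by
  rw [expBox, integrable_indicator_iff measurableSet_Ico]
  exact (Continuous.integrableOn_Icc (by fun_prop)).mono_set Ico_subset_Icc_self

theorem norm_expBox_le (a x : ℝ) : ‖expBox a x‖ ≤ Real.exp |a| := by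
  by_cases hx : x ∈ Ico (0 : ℝ) 1
  · rw [expBox, indicator_of_mem hx, Real.norm_of_nonneg (Real.exp_pos _).le, Real.exp_le_exp]
    calc a * x ≤ |a * x| := le_abs_self _
      _ = |a| * x := by rw [abs_mul, abs_of_nonneg hx.1]
      _ ≤ |a| * 1 := mul_le_mul_of_nonneg_left hx.2.le (abs_nonneg a)
      _ = |a| := mul_one _
  · rw [expBox, indicator_of_notMem hx, norm_zero]
    exact (Real.exp_pos _).le

theorem convolutionExistsAt_of_norm_le {f g : ℝ → ℝ} (hf : Integrable f) (hg : Integrable g)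
    {C : ℝ} (hC : ∀ x, ‖f x‖ ≤ C) (x : ℝ) :
    ConvolutionExistsAt f g x (ContinuousLinearMap.mul ℝ ℝ) volume :=
  (hg.comp_sub_left x).bdd_mul hf.aestronglyMeasurable (Eventually.of_forall hC)

theorem convolution_mul_comm (f g : ℝ → ℝ) :
    MeasureTheory.convolution f g (ContinuousLinearMap.mul ℝ ℝ) volume =
      MeasureTheory.convolution g f (ContinuousLinearMap.mul ℝ ℝ) volume := by
  ext x
  rw [convolution_mul_swap, convolution_def]
  simp [mul_comm]

/-- Associativity and commutativity of convolution; boundedness of `expBox` makes the convolutions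
exist at every point where associativity needs it. -/
theorem convolution_expBox_left_comm (a b : ℝ) {f : ℝ → ℝ} (hf : Integrable f) :
    MeasureTheory.convolution (expBox a) (MeasureTheory.convolution (expBox b) f
      (ContinuousLinearMap.mul ℝ ℝ) volume) (ContinuousLinearMap.mul ℝ ℝ) volume =
    MeasureTheory.convolution (expBox b) (MeasureTheory.convolution (expBox a) f
      (ContinuousLinearMap.mul ℝ ℝ) volume) (ContinuousLinearMap.mul ℝ ℝ) volume := by
  have assoc : ∀ a b : ℝ, MeasureTheory.convolution (MeasureTheory.convolution (expBox a)
      (expBox b) (ContinuousLinearMap.mul ℝ ℝ) volume) f (ContinuousLinearMap.mul ℝ ℝ) volume =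
      MeasureTheory.convolution (expBox a) (MeasureTheory.convolution (expBox b) f
        (ContinuousLinearMap.mul ℝ ℝ) volume) (ContinuousLinearMap.mul ℝ ℝ) volume := by
    intro a b
    ext x
    refine convolution_assoc _ _ _ _ (fun x y z => ?_)
      (integrable_expBox a).aestronglyMeasurable (integrable_expBox b).aestronglyMeasurable
      hf.aestronglyMeasurable
      (Eventually.of_forall fun y => convolutionExistsAt_of_norm_le (integrable_expBox a)
        (integrable_expBox b) (norm_expBox_le a) y)
      ((integrable_expBox b).norm.ae_convolution_exists _ hf.norm)
      (convolutionExistsAt_of_norm_le (integrable_expBox a).norm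
        ((integrable_expBox b).norm.integrable_convolution _ hf.norm)
        (fun x => by rw [norm_norm]; exact norm_expBox_le a x) x)
    simp [mul_assoc]
  rw [← assoc a b, ← assoc b a]
  congr 1
  exact convolution_mul_comm _ _

theorem integrable_ebSpline (l : List ℝ) : Integrable (ebSpline l) := by
  induction l with
  | nil => exact integrable_zero _ _ _
  | cons a l ih =>
    rcases eq_or_ne l [] with rfl | h
    · exact integrable_expBox a
    · rw [ebSpline_cons h]
      exact (integrable_expBox a).integrable_convolution _ ih

theorem List.Perm.ebSpline_eq {l₁ l₂ : List ℝ} (h : l₁.Perm l₂) : ebSpline l₁ = ebSpline l₂ := by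
  induction h with
  | nil => rfl
  | @cons a l₁ l₂ h ih =>
    rcases eq_or_ne l₁ [] with rfl | hne
    · rw [h.nil_eq]
    · rw [ebSpline_cons hne, ebSpline_cons (fun h2 => hne (h2 ▸ h).eq_nil), ih]
  | swap a b l =>
    rcases eq_or_ne l [] with rfl | hne
    · exact convolution_mul_comm _ _
    · rw [ebSpline_cons (by simp), ebSpline_cons hne, ebSpline_cons (by simp),
        ebSpline_cons hne, convolution_expBox_left_comm _ _ (integrable_ebSpline l)]
  | trans _ _ ih₁ ih₂ => exact ih₁.trans ih₂

/-! ### The alternating sum -/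

theorem convolution_expBox_apply (a : ℝ) (f : ℝ → ℝ) (x : ℝ) :
    MeasureTheory.convolution (expBox a) f (ContinuousLinearMap.mul ℝ ℝ) volume x =
      ∫ s in (0 : ℝ)..1, Real.exp (a * s) * f (x - s) := by
  rw [intervalIntegral.integral_of_le zero_le_one, ← integral_Ico_eq_integral_Ioc,
    ← integral_indicator measurableSet_Ico, convolution_def]
  congr 1
  ext s
  by_cases hs : s ∈ Ico (0 : ℝ) 1 <;> simp [expBox, indicator, hs]

/-- The finite set `S` is arbitrary so that one `S` serves all `x - s` with `s ∈ [0, 1]`: the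
support bound grows by one with each weight. This allows the sum and the integral to be exchanged.
-/
theorem zakHalf_eq_sum {l : List ℝ} (hl : l ≠ []) (x : ℝ) (S : Finset ℤ)
    (hS : ∀ k ∉ S, x + k ∉ Icc (0 : ℝ) l.length) :
    zakHalf l x = ∑ k ∈ S, (-1) ^ k * ebSpline l (x + k) := by
  induction l generalizing x S with
  | nil => exact absurd rfl hl
  | cons a l ih =>
    rcases eq_or_ne l [] with rfl | h
    · change antiExp a x = ∑ k ∈ S, (-1) ^ k * expBox a (x + k)
      have hfl := Int.floor_le x
      have hlt := Int.lt_floor_add_one x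
      -- The half-open box contains exactly one translate `x + k`.
      rw [Finset.sum_eq_single (-⌊x⌋)]
      · rw [expBox, indicator_of_mem, antiExp, Int.fract, zpow_neg, ← inv_zpow]
        · norm_num [sub_eq_add_neg]
        · push_cast
          exact ⟨by linarith, by linarith⟩
      · intro k _ hk
        rw [expBox, indicator_of_notMem, mul_zero]
        intro hmem
        apply hk
        have : ⌊x⌋ = -k := by
          rw [Int.floor_eq_iff]
          push_cast
          exact ⟨by linarith [hmem.1], by linarith [hmem.2]⟩
        omega
      · intro hk
        exfalso
        apply hS _ hk
        push_cast
        exact ⟨by linarith, by simp; linarith⟩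
    · rw [zakHalf_cons h, ebSpline_cons h, expMean]
      have h1 : ∫ s in (0 : ℝ)..1, Real.exp (a * s) * zakHalf l (x - s) =
          ∫ s in (0 : ℝ)..1, ∑ k ∈ S,
            (-1 : ℝ) ^ k * (Real.exp (a * s) * ebSpline l (x + k - s)) := by
        refine intervalIntegral.integral_congr fun s hs => ?_
        rw [uIcc_of_le zero_le_one] at hs
        rw [ih h (x - s) S, Finset.mul_sum]
        · refine Finset.sum_congr rfl fun k _ => ?_
          rw [show x - s + k = x + k - s by ring]
          ring
        · intro k hk hmem
          apply hS k hk
          push_cast [List.length_cons]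
          exact ⟨by linarith [hmem.1, hs.1], by linarith [hmem.2, hs.2]⟩
      rw [h1, intervalIntegral.integral_finsetSum]
      · refine Finset.sum_congr rfl fun k _ => ?_
        rw [intervalIntegral.integral_const_mul, convolution_expBox_apply]
      · intro k _
        refine IntervalIntegrable.const_mul (IntervalIntegrable.continuousOn_mul ?_
          (Continuous.continuousOn (by fun_prop))) _
        exact ((integrable_ebSpline l).comp_sub_left (x + k)).intervalIntegrable

theorem ebSpline_eq_zero {l : List ℝ} {x : ℝ} (hx : x ∉ Icc (0 : ℝ) l.length) :
    ebSpline l x = 0 := by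
  induction l generalizing x with
  | nil => rfl
  | cons a l ih =>
    rcases eq_or_ne l [] with rfl | h
    · have hm : x ∉ Ico (0 : ℝ) 1 := fun hm => hx ⟨hm.1, by simpa using hm.2.le⟩
      exact indicator_of_notMem hm fun x => Real.exp (a * x)
    · rw [ebSpline_cons h, convolution_expBox_apply]
      refine (intervalIntegral.integral_congr (g := fun _ => (0 : ℝ)) fun s hs => ?_).trans (by simp)
      rw [uIcc_of_le zero_le_one] at hs
      dsimp only
      rw [ih, mul_zero]
      intro hm
      apply hx
      push_cast [List.length_cons]
      exact ⟨by linarith [hm.1, hs.1], by linarith [hm.2, hs.2]⟩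

theorem zakTerm_half (f : ℝ → ℝ) (x : ℝ) (k : ℤ) :
    zakTerm (fun t => (f t : ℂ)) x (1 / 2) k = (((-1) ^ k * f (x + k) : ℝ) : ℂ) := by
  have h : Complex.exp (-2 * Real.pi * Complex.I * k * ((1 / 2 : ℝ) : ℂ)) = (-1) ^ k := by
    rw [show (-2 * Real.pi * Complex.I * k * ((1 / 2 : ℝ) : ℂ) : ℂ) =
      k * -(Real.pi * Complex.I) by push_cast; ring, Complex.exp_int_mul, Complex.exp_neg,
      Complex.exp_pi_mul_I]
    norm_num
  rw [zakTerm, h]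
  push_cast
  ring

theorem hasSum_zakTerm_ebSpline {l : List ℝ} (hl : l ≠ []) (x : ℝ) :
    HasSum (zakTerm (fun t => (ebSpline l t : ℂ)) x (1 / 2)) (zakHalf l x : ℂ) := by
  have hS : ∀ k ∉ Finset.Icc ⌈-x⌉ ⌊l.length - x⌋, x + (k : ℝ) ∉ Icc (0 : ℝ) l.length := by
    intro k hk hm
    apply hk
    rw [Finset.mem_Icc, Int.ceil_le, Int.le_floor]
    exact ⟨by linarith [hm.1], by linarith [hm.2]⟩
  rw [zakHalf_eq_sum hl x _ hS, Complex.ofReal_sum]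
  simp only [← zakTerm_half]
  refine hasSum_sum_of_ne_finset_zero fun k hk => ?_
  rw [zakTerm_half, ebSpline_eq_zero (hS k hk)]
  simp

/-- The recursion is not visibly symmetric in the weights; symmetry is inherited from the spline by
uniqueness of sums. -/
theorem List.Perm.zakHalf_eq {l₁ l₂ : List ℝ} (h : l₁.Perm l₂) : zakHalf l₁ = zakHalf l₂ := by
  rcases eq_or_ne l₁ [] with rfl | hne
  · rw [h.nil_eq]
  · ext x
    have h1 := hasSum_zakTerm_ebSpline hne x
    have h2 := hasSum_zakTerm_ebSpline (fun h2 => hne (h2 ▸ h).eq_nil : l₂ ≠ []) x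
    rw [h.ebSpline_eq] at h1
    exact_mod_cast h1.unique h2

/-! ### Derivatives of the alternating sum -/

theorem differentiableWithinAt_zakHalf {l : List ℝ} (hl : l ≠ []) (x : ℝ) :
    DifferentiableWithinAt ℝ (zakHalf l) (Ici x) x := by
  match l, hl with
  | [a], _ => exact (hasDerivWithinAt_antiExp a x).differentiableWithinAt
  | a :: b :: l, _ =>
    have h := isMonotoneAntiperiodic_zakHalf (List.cons_ne_nil b l)
    exact (hasDerivWithinAt_expMean h.antiperiodic h.locallyIntegrable a
      (h.rightContinuous x)).differentiableWithinAt

theorem continuous_zakHalf {l : List ℝ} (hl : 2 ≤ l.length) : Continuous (zakHalf l) := by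
  match l, hl with
  | a :: b :: l, _ =>
    have h := isMonotoneAntiperiodic_zakHalf (List.cons_ne_nil b l)
    exact continuous_expMean h.antiperiodic h.locallyIntegrable a

theorem differentiableAt_zakHalf {l : List ℝ} (hl : l ≠ []) {x : ℝ}
    (hx : 3 ≤ l.length ∨ ∀ k : ℤ, x ≠ k) : DifferentiableAt ℝ (zakHalf l) x := by
  induction l with
  | nil => exact absurd rfl hl
  | cons a l ih =>
    rcases eq_or_ne l [] with rfl | hne
    · exact (hasDerivAt_antiExp a (hx.resolve_left (by simp))).differentiableAt
    · rw [zakHalf_cons hne]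
      have h := isMonotoneAntiperiodic_zakHalf hne
      refine (hasDerivAt_expMean h.antiperiodic h.locallyIntegrable a ?_).differentiableAt
      rcases hx with hx | hx
      -- With three weights the tail has at least two, hence is continuous even at the integers.
      · exact (continuous_zakHalf (by simpa using hx)).continuousAt
      · exact (ih hne (Or.inr hx)).continuousAt

theorem exists_isMonotoneOn_zakHalf {l : List ℝ} (hl : l ≠ []) :
    ∃ x₀ : ℝ, ∀ k : ℤ, IsMonotoneOn (zakHalf l) (Ico (x₀ + k) (x₀ + k + 1)) := by
  have h := isMonotoneAntiperiodic_zakHalf hl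
  obtain ⟨x₀, hx₀⟩ := h.exists_monotoneOn
  exact ⟨x₀, h.antiperiodic.isMonotoneOn_Ico hx₀⟩

/-- With `a` moved to the front, `expDeriv a` undoes `expMean a` up to the positive factor `1 +
e^a`. If `a` is the only weight, it annihilates `antiExp a`. -/
theorem exists_isMonotoneOn_expDeriv_zakHalf {l : List ℝ} {a : ℝ} (ha : a ∈ l) :
    ∃ y₀ : ℝ, ∀ k : ℤ,
      IsMonotoneOn (expDeriv a (zakHalf l)) (Ico (y₀ + k) (y₀ + k + 1)) := by
  rw [(List.perm_cons_erase ha).zakHalf_eq]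
  rcases eq_or_ne (l.erase a) [] with h | h
  · have h0 : expDeriv a (zakHalf (a :: l.erase a)) = fun _ => 0 := by
      ext x
      rw [h]
      exact (expDeriv_eq_of_hasDerivWithinAt (hasDerivWithinAt_antiExp a x)).trans (sub_self _)
    rw [h0]
    exact ⟨0, fun k => Or.inl monotoneOn_const⟩
  · have hm := isMonotoneAntiperiodic_zakHalf h
    have h0 : expDeriv a (zakHalf (a :: l.erase a)) =
        fun x => (1 + Real.exp a) * zakHalf (l.erase a) x := by
      ext x
      rw [zakHalf_cons h]
      exact (expDeriv_eq_of_hasDerivWithinAt (hasDerivWithinAt_expMean hm.antiperiodic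
        hm.locallyIntegrable a (hm.rightContinuous x))).trans (add_sub_cancel_right _ _)
    obtain ⟨y₀, hy₀⟩ := exists_isMonotoneOn_zakHalf h
    rw [h0]
    exact ⟨y₀, fun k => (hy₀ k).const_mul (by positivity)⟩

theorem mem_weightList {r : ℕ} (η : Fin r → ℝ) {μ : Fin r → ℕ} {j : Fin r} (hj : 0 < μ j) :
    η j ∈ weightList η μ := by
  rw [weightList, List.mem_flatten]
  exact ⟨List.replicate (μ j) (η j), (List.mem_ofFn' _ _).2 ⟨j, rfl⟩,
    List.mem_replicate.2 ⟨hj.ne', rfl⟩⟩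

theorem mainTheorem7 (r : ℕ) (hr : 0 < r) (η : Fin r → ℝ) (hη : Function.Injective η)
    (μ : Fin r → ℕ) (hμ : ∀ j, 0 < μ j) :
    ∃ h : ℝ → ℝ,
      (∀ x : ℝ, Summable (zakTerm (fun t => (ebSpline (weightList η μ) t : ℂ)) x (1 / 2)) ∧
        zak (fun t => (ebSpline (weightList η μ) t : ℂ)) x (1 / 2) = (h x : ℂ)) ∧
      (∃ x₀ : ℝ, ∀ k : ℤ, IsMonotoneOn h (Set.Ico (x₀ + k) (x₀ + k + 1))) ∧
      (∀ x : ℝ, DifferentiableWithinAt ℝ h (Set.Ici x) x) ∧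
      (∀ x : ℝ, (3 ≤ (weightList η μ).length ∨ ∀ k : ℤ, x ≠ k) → DifferentiableAt ℝ h x) ∧
      (∀ n : Fin r, ∃ y₀ : ℝ, ∀ k : ℤ,
        IsMonotoneOn (expDeriv (η n) h) (Set.Ico (y₀ + k) (y₀ + k + 1))) := by
  have hl : weightList η μ ≠ [] := List.ne_nil_of_mem (mem_weightList η (hμ ⟨0, hr⟩))
  exact ⟨zakHalf (weightList η μ),
    fun x => ⟨(hasSum_zakTerm_ebSpline hl x).summable, (hasSum_zakTerm_ebSpline hl x).tsum_eq⟩,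
    exists_isMonotoneOn_zakHalf hl, differentiableWithinAt_zakHalf hl,
    fun x hx => differentiableAt_zakHalf hl hx,
    fun n => exists_isMonotoneOn_expDeriv_zakHalf (mem_weightList η (hμ n))⟩
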